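/- Say that a multiplicative lattice $L$ (for instance the lattice of all ideals of a commutative ring, ordered by inclusion and with ideal multiplication) is sharp if whenever $a_1a_2\le b$ with $a_1,a_2,b\in L$, there is a factorization $b=b_1b_2$ with $b_1,b_2\in L$, $a_1\le b_1$ and $a_2\le b_2$. A special primary ring is a commutative ring with identity which has a unique maximal ideal $M$ and in which each proper ideal (i.e. each ideal other than the whole ring, including the zero ideal) is a power of $M$. Let $R$ be a Noetherian commutative ring with identity. Then the ideal lattice of $R$ is sharp if and only if $R$ is isomorphic to a finite direct product of rings each of which is a Dedekind domain or a special primary ring. Here fields count as Dedekind domains, and the empty product (the zero ring) is allowed. -/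

import Mathlib

/-- A multiplicative lattice `L` is sharp if whenever `a₁ * a₂ ≤ b`, there is a factorization
`b = b₁ * b₂` with `a₁ ≤ b₁` and `a₂ ≤ b₂`. -/
def IsSharpLattice (L : Type*) [Lattice L] [CommMonoid L] : Prop :=
  ∀ a₁ a₂ b : L, a₁ * a₂ ≤ b → ∃ b₁ b₂ : L, b = b₁ * b₂ ∧ a₁ ≤ b₁ ∧ a₂ ≤ b₂

/-- A commutative ring is a special primary ring if it has a unique maximal ideal `M` and each
proper ideal (the zero ideal included) is a power of `M`. -/
def IsSpecialPrimaryRing (R : Type*) [CommRing R] : Prop :=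
  ∃ M : Ideal R, M.IsMaximal ∧ (∀ N : Ideal R, N.IsMaximal → N = M) ∧
    ∀ I : Ideal R, I ≠ ⊤ → ∃ n : ℕ, I = M ^ n

universe u

/-! Sharpness is used only for `M * M ≤ (x) + M²` with `x ∈ M \ M²`: it forces `(x) + M² = M`. By
Nakayama `M` is then locally generated by `x`. A prime `P` strictly below `M` misses `x`, so locally
`P = xP = 0`; hence a non-maximal prime satisfies `P + ann P = R` and is idempotent. If `R ≠ 0` has
only trivial idempotents, such a `P` is `0`, and `R` is a domain whose localizations at nonzero
primes are DVRs; with no such `P`, `R` is Artinian, some power of a maximal ideal vanishes, and `R`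
is special primary. Noetherian induction splits off idempotents. Conversely, both kinds of factor
are sharp and sharpness passes to finite products. -/

/-- Every maximal ideal `M` is generated by a single element modulo `M * M`. -/
def MaximalIdealsCyclicModSquare (R : Type*) [CommRing R] : Prop :=
  ∀ M : Ideal R, M.IsMaximal → ∃ x ∈ M, M ≤ Ideal.span {x} ⊔ M * M

/-- The ring is a finite product of Dedekind domains and special primary rings. -/
def IsProductDedekindSpecialPrimary (R : Type u) [CommRing R] : Prop :=
  ∃ (ι : Type) (_ : Finite ι) (S : ι → Type u) (_ : ∀ i, CommRing (S i)),
    (∀ i, IsDedekindDomain (S i) ∨ IsSpecialPrimaryRing (S i)) ∧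
      Nonempty (R ≃+* ((i : ι) → S i))

/-! ### Sharpness of the factors and of their products -/

theorem isSharpLattice_ideal_of_isDedekindDomain (R : Type*) [CommRing R] [IsDedekindDomain R] :
    IsSharpLattice (Ideal R) := by
  intro a₁ a₂ b h
  obtain ⟨b₁, b₂, h₁, h₂, h₃⟩ := exists_dvd_and_dvd_of_dvd_mul (Ideal.dvd_iff_le.mpr h)
  exact ⟨b₁, b₂, h₃, Ideal.le_of_dvd h₁, Ideal.le_of_dvd h₂⟩

theorem IsSpecialPrimaryRing.isSharpLattice_ideal {R : Type*} [CommRing R]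
    (hR : IsSpecialPrimaryRing R) : IsSharpLattice (Ideal R) := by
  obtain ⟨M, -, -, hpow⟩ := hR
  have hpow' : ∀ I : Ideal R, ∃ n : ℕ, I = M ^ n := fun I ↦ by
    by_cases hI : I = ⊤
    · exact ⟨0, by rw [hI, pow_zero, Ideal.one_eq_top]⟩
    · exact hpow I hI
  intro a₁ a₂ b h
  obtain ⟨i, rfl⟩ := hpow' a₁
  obtain ⟨j, rfl⟩ := hpow' a₂
  obtain ⟨k, rfl⟩ := hpow' b
  rcases le_total k (i + j) with hk | hk
  · exact ⟨M ^ min i k, M ^ (k - min i k), by rw [← pow_add]; congr 1; omega,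
      Ideal.pow_le_pow_right (min_le_left i k), Ideal.pow_le_pow_right (by omega)⟩
  -- Here `M ^ k ≤ M ^ (i + j)`, and the hypothesis is the reverse inclusion.
  · exact ⟨M ^ i, M ^ j, le_antisymm (pow_add M i j ▸ Ideal.pow_le_pow_right hk) h, le_rfl, le_rfl⟩

theorem IsSharpLattice.of_ringEquiv {R S : Type*} [CommRing R] [CommRing S] (e : R ≃+* S)
    (h : IsSharpLattice (Ideal S)) : IsSharpLattice (Ideal R) := by
  intro a₁ a₂ b hab
  obtain ⟨b₁, b₂, hb, h₁, h₂⟩ := h (a₁.map e) (a₂.map e) (b.map e)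
    (by rw [← Ideal.map_mul]; exact Ideal.map_mono hab)
  refine ⟨b₁.map e.symm, b₂.map e.symm, ?_, ?_, ?_⟩
  · rw [← Ideal.map_mul, ← hb]; exact (Ideal.map_of_equiv e).symm
  · exact (Ideal.map_of_equiv (I := a₁) e).ge.trans (Ideal.map_mono h₁)
  · exact (Ideal.map_of_equiv (I := a₂) e).ge.trans (Ideal.map_mono h₂)

theorem IsSharpLattice.pi {ι : Type*} [Finite ι] {S : ι → Type*} [∀ i, CommRing (S i)]
    (h : ∀ i, IsSharpLattice (Ideal (S i))) : IsSharpLattice (Ideal (∀ i, S i)) := by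
  intro a₁ a₂ b hab
  have hi : ∀ i, a₁.map (Pi.evalRingHom S i) * a₂.map (Pi.evalRingHom S i) ≤
      b.map (Pi.evalRingHom S i) := fun i ↦ by
    rw [← Ideal.map_mul]; exact Ideal.map_mono hab
  choose b₁ b₂ hb h₁ h₂ using fun i ↦ h i _ _ _ (hi i)
  have key : ∀ i, b.map (Pi.evalRingHom S i) =
      (Ideal.pi b₁ * Ideal.pi b₂).map (Pi.evalRingHom S i) := fun i ↦ by
    rw [Ideal.map_mul, Ideal.map_evalRingHom_pi, Ideal.map_evalRingHom_pi, hb i]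
  exact ⟨Ideal.pi b₁, Ideal.pi b₂,
    Ideal.piOrderIso.injective (funext key),
    fun x hx i ↦ h₁ i (Ideal.mem_map_of_mem (Pi.evalRingHom S i) hx),
    fun x hx i ↦ h₂ i (Ideal.mem_map_of_mem (Pi.evalRingHom S i) hx)⟩

/-! ### From sharpness to cyclic `M / M²` -/

theorem IsSharpLattice.maximalIdealsCyclicModSquare {R : Type*} [CommRing R]
    (h : IsSharpLattice (Ideal R)) : MaximalIdealsCyclicModSquare R := by
  intro M hM
  by_cases hMM : M ≤ M * M
  · exact ⟨0, M.zero_mem, hMM.trans le_sup_right⟩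
  obtain ⟨x, hx, hx'⟩ := SetLike.not_le_iff_exists.mp hMM
  refine ⟨x, hx, ?_⟩
  obtain ⟨b₁, b₂, hb, h₁, h₂⟩ := h M M (Ideal.span {x} ⊔ M * M) le_sup_right
  rw [hb]
  -- Both factors contain `M`, so each is `M` or `⊤`; the product `M * M` is excluded by the choice
  -- of `x`.
  by_cases h₁' : b₁ = ⊤
  · rwa [h₁', Ideal.top_mul]
  · obtain rfl := hM.eq_of_le h₁' h₁
    by_cases h₂' : b₂ = ⊤
    · rw [h₂', Ideal.mul_top]
    · rw [← hM.eq_of_le h₂' h₂] at hb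
      exact absurd (hb ▸ Ideal.mem_sup_left (Ideal.mem_span_singleton_self x)) hx'

theorem MaximalIdealsCyclicModSquare.of_surjective {R S : Type*} [CommRing R] [CommRing S]
    (h : MaximalIdealsCyclicModSquare R) (f : R →+* S) (hf : Function.Surjective f) :
    MaximalIdealsCyclicModSquare S := by
  intro M hM
  have := Ideal.comap_isMaximal_of_surjective f hf (K := M)
  obtain ⟨x, hx, hle⟩ := h (M.comap f) this
  refine ⟨f x, hx, ?_⟩
  have := Ideal.map_mono (f := f) hle
  rwa [Ideal.map_sup, Ideal.map_mul, Ideal.map_comap_of_surjective f hf, Ideal.map_span,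
    Set.image_singleton] at this

theorem Ideal.IsMaximal.notMem_of_sub_one_mem {R : Type*} [CommRing R] {M : Ideal R}
    (hM : M.IsMaximal) {s : R} (hs : s - 1 ∈ M) : s ∉ M := fun h ↦
  hM.ne_top ((Ideal.eq_top_iff_one M).mpr (by simpa using M.sub_mem h hs))

/-! ### Noetherian rings with cyclic `M / M²` -/

section Noetherian

variable {R : Type*} [CommRing R] [IsNoetherianRing R]

/-- Nakayama's lemma with denominators cleared: `M` becomes principal once `s` is inverted. -/
theorem MaximalIdealsCyclicModSquare.exists_mul_mem_span (h : MaximalIdealsCyclicModSquare R)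
    {M : Ideal R} (hM : M.IsMaximal) :
    ∃ x ∈ M, ∃ s : R, s ∉ M ∧ ∀ m ∈ M, s * m ∈ Ideal.span {x} := by
  obtain ⟨x, hx, hle⟩ := h M hM
  obtain ⟨s, hs, hs'⟩ := Submodule.exists_sub_one_mem_and_smul_le_of_fg_of_le_sup
    (I := M) (N := Ideal.span {x}) (N' := M) (P := M) (IsNoetherian.noetherian M) le_rfl hle
  exact ⟨x, hx, s, hM.notMem_of_sub_one_mem hs,
    fun m hm ↦ hs' (Submodule.smul_mem_pointwise_smul m s M hm)⟩

theorem MaximalIdealsCyclicModSquare.exists_annihilator_notMem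
    (h : MaximalIdealsCyclicModSquare R) {P M : Ideal R} (hP : P.IsPrime) (hM : M.IsMaximal)
    (hPM : P < M) : ∃ r, r ∉ M ∧ ∀ p ∈ P, r * p = 0 := by
  obtain ⟨x, hx, s, hs, hsM⟩ := h.exists_mul_mem_span hM
  have hxP : x ∉ P := fun hxP ↦ hPM.not_ge fun m hm ↦
    (hP.mem_or_mem ((Ideal.span_singleton_le_iff_mem P).mpr hxP (hsM m hm))).resolve_left
      fun hsP ↦ hs (hPM.le hsP)
  obtain ⟨t, ht⟩ := hM.exists_inv hs
  obtain ⟨m, hm, htm⟩ := ht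
  have hle : P ≤ M • P := fun p hp ↦ by
    -- From `s * p = a * x` with `x ∉ P`, primality gives `a ∈ P`; then `t * s + m = 1` puts `p` in
    -- `M * P`.
    obtain ⟨a, ha⟩ := Ideal.mem_span_singleton'.mp (hsM p (hPM.le hp))
    have haP : a ∈ P :=
      (hP.mem_or_mem (ha ▸ P.mul_mem_left s hp : a * x ∈ P)).resolve_right hxP
    have : p = t * (x * a) + m * p := by linear_combination p * (-htm) - t * ha
    rw [this]
    exact add_mem (Ideal.mul_mem_left _ t (Ideal.mul_mem_mul hx haP)) (Ideal.mul_mem_mul hm hp)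
  obtain ⟨r, hr, hr'⟩ := Submodule.exists_sub_one_mem_and_smul_eq_zero_of_fg_of_le_smul M P
    (IsNoetherian.noetherian P) hle
  exact ⟨r, hM.notMem_of_sub_one_mem hr, hr'⟩

theorem MaximalIdealsCyclicModSquare.isIdempotentElem_of_not_isMaximal
    (h : MaximalIdealsCyclicModSquare R) {P : Ideal R} (hP : P.IsPrime) (hPM : ¬ P.IsMaximal) :
    IsIdempotentElem P := by
  have htop : P ⊔ P.annihilator = ⊤ := by
    by_contra hne
    obtain ⟨M, hM, hle⟩ := Ideal.exists_le_maximal _ hne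
    have hlt : P < M := lt_of_le_of_ne (le_sup_left.trans hle) fun e ↦ hPM (e ▸ hM)
    obtain ⟨r, hr, hrP⟩ := h.exists_annihilator_notMem hP hM hlt
    exact hr (hle (Ideal.mem_sup_right (Submodule.mem_annihilator.mpr hrP)))
  have : P * (P ⊔ P.annihilator) = P * P := by
    rw [Ideal.mul_sup, Ideal.mul_comm P P.annihilator, Submodule.annihilator_mul, sup_bot_eq]
  rw [IsIdempotentElem, ← this, htop, Ideal.mul_top]

theorem Ideal.eq_bot_or_eq_top_of_isIdempotentElem
    (hc : ∀ e : R, IsIdempotentElem e → e = 0 ∨ e = 1) {I : Ideal R} (hI : IsIdempotentElem I) :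
    I = ⊥ ∨ I = ⊤ := by
  obtain ⟨e, he, rfl⟩ := (I.isIdempotentElem_iff_of_fg (IsNoetherian.noetherian I)).mp hI
  rcases hc e he with rfl | rfl
  · exact Or.inl (Ideal.span_singleton_eq_bot.mpr rfl)
  · exact Or.inr Ideal.span_singleton_one

theorem MaximalIdealsCyclicModSquare.isDedekindDomain [IsDomain R]
    (h : MaximalIdealsCyclicModSquare R) (hc : ∀ e : R, IsIdempotentElem e → e = 0 ∨ e = 1) :
    IsDedekindDomain R := by
  have : IsDedekindDomainDvr R :=
    { (inferInstance : IsNoetherian R R) with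
      is_dvr_at_nonzero_prime := by
        intro P hP hprime
        have hM : P.IsMaximal := by
          by_contra hPM
          exact (Ideal.eq_bot_or_eq_top_of_isIdempotentElem hc
            (h.isIdempotentElem_of_not_isMaximal hprime hPM)).elim hP hprime.ne_top
        obtain ⟨x, hx, s, hs, hsM⟩ := h.exists_mul_mem_span hM
        have hnf := IsLocalization.AtPrime.not_isField R hP (Localization.AtPrime P)
        have hnoeth : IsNoetherianRing (Localization.AtPrime P) :=
          IsLocalization.isNoetherianRing P.primeCompl _ inferInstance
        refine ((IsDiscreteValuationRing.TFAE (Localization.AtPrime P) hnf).out 0 4).mpr ?_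
        refine ⟨algebraMap R _ x, le_antisymm ?_ ?_⟩
        · rw [← Localization.AtPrime.map_eq_maximalIdeal, Ideal.map_le_iff_le_comap]
          intro m hm
          have hu : IsUnit (algebraMap R (Localization.AtPrime P) s) :=
            IsLocalization.map_units _ (⟨s, hs⟩ : P.primeCompl)
          refine Ideal.mem_comap.mpr ((Ideal.unit_mul_mem_iff_mem _ hu).mp ?_)
          rw [← map_mul]
          obtain ⟨a, ha⟩ := Ideal.mem_span_singleton'.mp (hsM m hm)
          exact Ideal.mem_span_singleton'.mpr ⟨algebraMap R _ a, by rw [← map_mul, ha]⟩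
        · refine (Ideal.span_singleton_le_iff_mem _).mpr ?_
          rw [← Localization.AtPrime.map_eq_maximalIdeal]
          exact Ideal.mem_map_of_mem _ hx }
  infer_instance

theorem isSpecialPrimaryRing_of_pow_eq_bot (h : MaximalIdealsCyclicModSquare R) {M : Ideal R}
    (hM : M.IsMaximal) {n : ℕ} (hn : M ^ n = ⊥) : IsSpecialPrimaryRing R := by
  -- Every maximal `N` contains `M ^ n = ⊥`, hence contains `M`.
  have huniq : ∀ N : Ideal R, N.IsMaximal → N = M := fun N hN ↦
    (hM.eq_of_le hN.ne_top (hN.isPrime.le_of_pow_le (hn ▸ bot_le))).symm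
  have hunit : ∀ s ∉ M, IsUnit s := fun s hs ↦ by
    by_contra hu
    obtain ⟨N, hN, hsN⟩ := exists_max_ideal_of_mem_nonunits hu
    exact hs (huniq N hN ▸ hsN)
  obtain ⟨x, hx, s, hs, hsM⟩ := h.exists_mul_mem_span hM
  have hMx : M = Ideal.span {x} := le_antisymm
    (fun m hm ↦ (Ideal.unit_mul_mem_iff_mem _ (hunit s hs)).mp (hsM m hm))
    ((Ideal.span_singleton_le_iff_mem M).mpr hx)
  refine ⟨M, hM, huniq, fun I _ ↦ ?_⟩
  by_cases hI : I ≤ M ^ n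
  · exact ⟨n, le_antisymm hI (hn ▸ bot_le)⟩
  -- For the last power `M ^ k` containing `I`, an element of `I` outside `M ^ (k + 1)` is a unit
  -- times `x ^ k`.
  classical
  have hex : ∃ k, ¬ I ≤ M ^ k := ⟨n, hI⟩
  obtain ⟨k, hk⟩ : ∃ k, Nat.find hex = k + 1 := Nat.exists_eq_succ_of_ne_zero fun h0 ↦
    Nat.find_spec hex (by rw [h0, pow_zero, Ideal.one_eq_top]; exact le_top)
  have hIk : I ≤ M ^ k := not_not.mp (Nat.find_min hex (by omega))
  have hIk' : ¬ I ≤ M ^ (k + 1) := hk ▸ Nat.find_spec hex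
  refine ⟨k, le_antisymm hIk ?_⟩
  obtain ⟨y, hy, hy'⟩ := SetLike.not_le_iff_exists.mp hIk'
  have hyk := hIk hy
  rw [hMx, Ideal.span_singleton_pow] at hyk
  obtain ⟨u, rfl⟩ := Ideal.mem_span_singleton'.mp hyk
  have hu : u ∉ M := fun hu ↦ hy' (by
    rw [pow_succ']
    exact Ideal.mul_mem_mul hu (Ideal.pow_mem_pow hx k))
  rw [hMx, Ideal.span_singleton_pow, Ideal.span_singleton_le_iff_mem]
  exact (Ideal.unit_mul_mem_iff_mem I (hunit u hu)).mp hy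

theorem MaximalIdealsCyclicModSquare.isDedekindDomain_or_isSpecialPrimaryRing [Nontrivial R]
    (h : MaximalIdealsCyclicModSquare R) (hc : ∀ e : R, IsIdempotentElem e → e = 0 ∨ e = 1) :
    IsDedekindDomain R ∨ IsSpecialPrimaryRing R := by
  by_cases hdim : ∀ P : Ideal R, P.IsPrime → P.IsMaximal
  · right
    have : Ring.KrullDimLE 0 R := Ring.krullDimLE_zero_iff.mpr hdim
    have : IsArtinianRing R := IsNoetherianRing.isArtinianRing_of_krullDimLE_zero
    obtain ⟨M, hM⟩ := Ideal.exists_maximal R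
    obtain ⟨n, hn⟩ := IsArtinian.monotone_stabilizes
      (⟨fun k ↦ OrderDual.toDual (M ^ k), fun i j hij ↦ Ideal.pow_le_pow_right hij⟩ :
        ℕ →o (Ideal R)ᵒᵈ)
    replace hn : ∀ m, n ≤ m → M ^ n = M ^ m := hn
    -- The positive exponent `n + 1` gives `M ^ (n + 1) ≤ M`, which rules out `⊤` below.
    have hidem : IsIdempotentElem (M ^ (n + 1)) := by
      rw [IsIdempotentElem, ← pow_add, ← hn (n + 1) (by omega),
        ← hn (n + 1 + (n + 1)) (by omega)]
    rcases Ideal.eq_bot_or_eq_top_of_isIdempotentElem hc hidem with h0 | h1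
    · exact isSpecialPrimaryRing_of_pow_eq_bot h hM h0
    · exact absurd (top_le_iff.mp (h1 ▸ Ideal.pow_le_self n.succ_ne_zero)) hM.ne_top
  · left
    push Not at hdim
    obtain ⟨P, hP, hPM⟩ := hdim
    have hbot := (Ideal.eq_bot_or_eq_top_of_isIdempotentElem hc
      (h.isIdempotentElem_of_not_isMaximal hP hPM)).resolve_right hP.ne_top
    have : IsDomain R := by
      have : (⊥ : Ideal R).IsPrime := hbot ▸ hP
      exact IsDomain.of_bot_isPrime R
    exact h.isDedekindDomain hc

end Noetherian

/-! ### Splitting along idempotents -/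

theorem IsProductDedekindSpecialPrimary.of_ringEquiv {R S : Type u} [CommRing R] [CommRing S]
    (hS : IsProductDedekindSpecialPrimary S) (e : R ≃+* S) :
    IsProductDedekindSpecialPrimary R := by
  obtain ⟨ι, hι, T, hT, h, ⟨f⟩⟩ := hS
  exact ⟨ι, hι, T, hT, h, ⟨e.trans f⟩⟩

theorem IsProductDedekindSpecialPrimary.prod {R S : Type u} [CommRing R] [CommRing S]
    (hR : IsProductDedekindSpecialPrimary R) (hS : IsProductDedekindSpecialPrimary S) :
    IsProductDedekindSpecialPrimary (R × S) := by
  obtain ⟨ι, hι, T, hT, h, ⟨f⟩⟩ := hR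
  obtain ⟨κ, hκ, U, hU, k, ⟨g⟩⟩ := hS
  let V : ι ⊕ κ → Type u := Sum.elim T U
  let hV : ∀ i, CommRing (V i) := fun i ↦ Sum.rec hT hU i
  let e : (∀ i, V i) ≃+* (∀ i, T i) × (∀ j, U j) :=
    { Equiv.sumPiEquivProdPi V with
      map_mul' := fun _ _ ↦ rfl
      map_add' := fun _ _ ↦ rfl }
  exact ⟨ι ⊕ κ, inferInstance, V, hV, fun i ↦ Sum.rec h k i, ⟨(f.prodCongr g).trans e.symm⟩⟩

theorem isProductDedekindSpecialPrimary_of_subsingleton (R : Type u) [CommRing R]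
    [Subsingleton R] : IsProductDedekindSpecialPrimary R :=
  ⟨PEmpty, inferInstance, fun _ ↦ R, fun _ ↦ inferInstance, fun i ↦ i.elim,
    ⟨{ toFun := fun _ i ↦ i.elim
       invFun := fun _ ↦ 0
       left_inv := fun _ ↦ Subsingleton.elim _ _
       right_inv := fun _ ↦ funext fun i ↦ i.elim
       map_mul' := fun _ _ ↦ funext fun i ↦ i.elim
       map_add' := fun _ _ ↦ funext fun i ↦ i.elim }⟩⟩

theorem isProductDedekindSpecialPrimary_of_factor (R : Type u) [CommRing R]
    (h : IsDedekindDomain R ∨ IsSpecialPrimaryRing R) : IsProductDedekindSpecialPrimary R :=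
  ⟨Unit, inferInstance, fun _ ↦ R, fun _ ↦ inferInstance, fun _ ↦ h,
    ⟨(RingEquiv.piUnique fun _ : Unit ↦ R).symm⟩⟩

/-- Quotients of a fixed `R` allow Noetherian induction on `I`: a nontrivial idempotent `e` of `R ⧸
I` splits it into quotients by the strictly larger ideals `I + (e)` and `I + (1 - e)`. -/
theorem MaximalIdealsCyclicModSquare.isProduct_quotient {R : Type u} [CommRing R]
    [IsNoetherianRing R] (h : MaximalIdealsCyclicModSquare R) (I : Ideal R) :
    IsProductDedekindSpecialPrimary (R ⧸ I) := by
  induction I using IsNoetherian.induction with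
  | hgt I ih =>
    rcases subsingleton_or_nontrivial (R ⧸ I) with hs | hn
    · exact isProductDedekindSpecialPrimary_of_subsingleton _
    by_cases hc : ∀ e : R ⧸ I, IsIdempotentElem e → e = 0 ∨ e = 1
    · exact isProductDedekindSpecialPrimary_of_factor _
        ((h.of_surjective _ Ideal.Quotient.mk_surjective).isDedekindDomain_or_isSpecialPrimaryRing
          hc)
    push Not at hc
    obtain ⟨e', he, he0, he1⟩ := hc
    obtain ⟨e, rfl⟩ := Ideal.Quotient.mk_surjective e'
    have heI : e * (1 - e) ∈ I := by
      rw [← Ideal.Quotient.eq_zero_iff_mem, map_mul, map_sub, map_one, mul_sub, mul_one, he.eq,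
        sub_self]
    replace he0 : e ∉ I := fun hm ↦ he0 (Ideal.Quotient.eq_zero_iff_mem.mpr hm)
    replace he1 : 1 - e ∉ I := fun hm ↦ he1 (Ideal.Quotient.eq.mpr hm).symm
    have lt_of : ∀ a ∉ I, I < I ⊔ Ideal.span {a} := fun a ha ↦
      lt_of_le_of_ne le_sup_left fun heq ↦ ha (by
        rw [heq]; exact Ideal.mem_sup_right (Ideal.mem_span_singleton_self a))
    have hcop : IsCoprime (I ⊔ Ideal.span {e}) (I ⊔ Ideal.span {1 - e}) :=
      Ideal.isCoprime_iff_exists.mpr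
        ⟨e, Ideal.mem_sup_right (Ideal.mem_span_singleton_self _), 1 - e,
          Ideal.mem_sup_right (Ideal.mem_span_singleton_self _), by ring⟩
    have hinf : (I ⊔ Ideal.span {e}) ⊓ (I ⊔ Ideal.span {1 - e}) = I := by
      refine le_antisymm ?_ (le_inf le_sup_left le_sup_left)
      rw [← Ideal.mul_eq_inf_of_isCoprime hcop, Ideal.sup_mul, Ideal.mul_sup (Ideal.span {e}),
        Ideal.span_singleton_mul_span_singleton]
      exact sup_le Ideal.mul_le_left
        (sup_le Ideal.mul_le_right ((Ideal.span_singleton_le_iff_mem I).mpr heI))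
    exact ((ih _ (lt_of _ he0)).prod (ih _ (lt_of _ he1))).of_ringEquiv
      ((Ideal.quotEquivOfEq hinf.symm).trans (Ideal.quotientInfEquivQuotientProd _ _ hcop))

theorem mainTheorem9 {R : Type u} [CommRing R] [IsNoetherianRing R] :
    IsSharpLattice (Ideal R) ↔
      ∃ (n : ℕ) (S : Fin n → Type u) (_ : ∀ i, CommRing (S i)),
        (∀ i, IsDedekindDomain (S i) ∨ IsSpecialPrimaryRing (S i)) ∧
          Nonempty (R ≃+* ((i : Fin n) → S i)) := by
  constructor
  · intro h
    obtain ⟨ι, hι, S, hS, hfac, ⟨f⟩⟩ :=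
      (h.maximalIdealsCyclicModSquare.isProduct_quotient ⊥).of_ringEquiv
        (RingEquiv.quotientBot R).symm
    let e := (Finite.equivFin ι).symm
    exact ⟨Nat.card ι, fun i ↦ S (e i), fun i ↦ hS (e i), fun i ↦ hfac (e i),
      ⟨f.trans (RingEquiv.piCongrLeft S e).symm⟩⟩
  · rintro ⟨n, S, hS, hfac, ⟨e⟩⟩
    refine IsSharpLattice.of_ringEquiv e (IsSharpLattice.pi fun i ↦ ?_)
    rcases hfac i with hD | hP
    · exact isSharpLattice_ideal_of_isDedekindDomain (S i)
    · exact hP.isSharpLattice_ideal
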